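/- Let $\mathcal D$ be a link diagram in the $2$-sphere $\mathbb S^2$: a non-empty finite $4$-valent graph embedded in $\mathbb S^2$ (a closed curve without crossings being allowed as well), with over/under information at each vertex (crossing). Assume that all regions of $\mathcal D$ (components of the complement of the graph) are contractible, that is, that the underlying graph is connected. Let $\mathcal D$ be checkerboard shaded, i.e. some of its regions are shaded so that whenever two regions share an arc exactly one of them is shaded. The Tait graph $G$ of the shaded diagram has one vertex for each shaded region and, for each crossing $c$, one edge joining the shaded regions at the two shaded corners of $c$ (possibly a loop); its weight is $+1$ if, turning counterclockwise about $c$ through a shaded corner, one passes from the under strand to the over strand, and $-1$ otherwise. The dual graph $G^*$ is the Tait graph of the opposite shading, in which shaded and unshaded regions are exchanged. For a finite graph $G$ with vertices $v_1,\dots,v_n$ and integer edge weights, let $A$ be the $n\times n$ matrix whose $(i,j)$ entry is the sum of the weights of the edges between $v_i$ and $v_j$, and let $\delta$ be the diagonal matrix whose $i$-th diagonal entry is the sum of the weights of the edges incident on $v_i$, loops being counted twice in both. Put $L_G=\delta-A$ and let the Laplacian group be $\mathcal L_G=\mathbb Z^n/L_G\mathbb Z^n$. Then the Laplacian groups $\mathcal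 L_G$ and $\mathcal L_{G^*}$ are isomorphic. -/

import Mathlib

/-! ### Edge-weighted finite multigraphs and their Laplacian groups -/

/-- An edge-weighted multigraph with vertex set `V` and edge set `E`. Loops and parallel edges are
allowed. The two ends of an edge are listed in some order, which plays no role below. -/
structure WeightedGraph (V E : Type*) where
  fst : E → V
  snd : E → V
  weight : E → ℤ

namespace WeightedGraph

open Classical in
/-- The adjacency matrix: the `(i, j)` entry is the sum of the weights of the edges between `i` and
`j`; a loop at `i` is counted twice in the `(i, i)` entry. -/
noncomputable def adjacency {V E : Type*} [Fintype E] (G : WeightedGraph V E) : Matrix V V ℤ :=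
  Matrix.of fun i j => ∑ e : E, G.weight e *
    ((if G.fst e = i ∧ G.snd e = j then 1 else 0) + (if G.fst e = j ∧ G.snd e = i then 1 else 0))

open Classical in
/-- The sum of the weights of the edges incident on `i`, loops counted twice. -/
noncomputable def degree {V E : Type*} [Fintype E] (G : WeightedGraph V E) (i : V) : ℤ :=
  ∑ e : E, G.weight e * ((if G.fst e = i then 1 else 0) + (if G.snd e = i then 1 else 0))

open Classical in
/-- The Laplacian matrix `δ - A`. -/
noncomputable def laplacian {V E : Type*} [Fintype E] (G : WeightedGraph V E) : Matrix V V ℤ :=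
  Matrix.diagonal G.degree - G.adjacency

/-- The Laplacian group, the cokernel `ℤ^V / L ℤ^V` of the Laplacian matrix. -/
abbrev LaplacianGroup {V E : Type*} [Fintype V] [Fintype E] (G : WeightedGraph V E) : Type _ :=
  (V → ℤ) ⧸ LinearMap.range G.laplacian.mulVecLin

end WeightedGraph

/-! ### Link diagrams on closed oriented surfaces -/

/-- The arc ends of a diagram with crossing set `X` and set `M` of marked points. Around a
crossing `c` there are four arc ends `(c, 0), (c, 1), (c, 2), (c, 3)`, in counterclockwise order;
`(c, 0)` and `(c, 2)` belong to the strand passing under, `(c, 1)` and `(c, 3)` to the strand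
passing over. A marked point `m` is a point in the interior of an arc, which it subdivides, with
two arc ends `(m, 0), (m, 1)`. -/
abbrev LinkDiagram.Dart (X M : Type*) := (X × ZMod 4) ⊕ (M × ZMod 2)

/-- The permutation taking an arc end to the counterclockwise next one at the same point. -/
def LinkDiagram.next (X M : Type*) : Equiv.Perm (LinkDiagram.Dart X M) :=
  Equiv.sumCongr (Equiv.prodCongr (Equiv.refl X) (Equiv.addRight 1))
    (Equiv.prodCongr (Equiv.refl M) (Equiv.addRight 1))

/-- A link diagram on a closed oriented surface all of whose regions are open discs, given as a
planar diagram code, that is, as a combinatorial map (rotation system): crossings `X` with their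
arc ends in counterclockwise order, and the involution `opp` which joins the arc ends in pairs to
form the arcs. Marked points `M` on the arcs are optional (`M` may be empty); they are there so
that a closed curve without crossings is a diagram too. -/
structure LinkDiagram (X M : Type*) where
  opp : Equiv.Perm (LinkDiagram.Dart X M)
  opp_opp : ∀ d, opp (opp d) = d
  opp_ne : ∀ d, opp d ≠ d

namespace LinkDiagram

variable {X M : Type*}

/-- The underlying graph (universe) of the diagram is connected. -/
def IsConnected (D : LinkDiagram X M) : Prop :=
  ∀ a b : Dart X M, ∃ g ∈ Subgroup.closure {next X M, D.opp}, g a = b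

/-- An arc end `d` also stands for the corner between `d` and `next d`, which lies to the left of
`d` when one leaves along `d`. The permutation `face` takes this corner to the following one along
the boundary of the same region: leave along `d`, arrive at `opp d`, and take the corner on the
left, which is the one clockwise from `opp d`. -/
def face (D : LinkDiagram X M) : Equiv.Perm (Dart X M) :=
  D.opp.trans (next X M).symm

/-- The regions of the diagram: the cycles of corners under `face`. -/
def Region (D : LinkDiagram X M) : Type _ :=
  Quotient (Equiv.Perm.SameCycle.setoid D.face)

/-- The region containing the corner between `d` and `next d`, to the left of `d`. -/
def region (D : LinkDiagram X M) (d : Dart X M) : D.Region :=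
  Quotient.mk (Equiv.Perm.SameCycle.setoid D.face) d

/-- The arcs (subdivided by the marked points, if any): the pairs `{d, opp d}`. -/
def Arc (D : LinkDiagram X M) : Type _ :=
  Quotient (Equiv.Perm.SameCycle.setoid D.opp)

/-- The Euler characteristic of the surface: number of points of the graph, minus number of arcs,
plus number of regions. -/
noncomputable def eulerChar (D : LinkDiagram X M) : ℤ :=
  ((Nat.card X : ℤ) + Nat.card M) - Nat.card D.Arc + Nat.card D.Region

/-- The diagram is a diagram in the 2-sphere with contractible regions: it is connected, and the
closed oriented surface on which it lies has Euler characteristic 2. -/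
def IsSpherical (D : LinkDiagram X M) : Prop :=
  D.IsConnected ∧ D.eulerChar = 2

instance (D : LinkDiagram X M) [Finite X] [Finite M] : Finite D.Region :=
  inferInstanceAs (Finite (Quotient _))

/-- A checkerboard shading: whenever two regions share an arc (the region to the left of `d` and
the region to the left of `opp d`), exactly one of them is shaded. -/
structure Shading (D : LinkDiagram X M) where
  shaded : Set D.Region
  alternates : ∀ d, D.region d ∈ shaded ↔ D.region (D.opp d) ∉ shaded

namespace Shading

variable {D : LinkDiagram X M}

/-- The other checkerboard shading. -/
def other (s : D.Shading) : D.Shading where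
  shaded := s.shadedᶜ
  alternates d := by
    have := s.alternates d
    simp only [Set.mem_compl_iff]
    tauto

theorem next_mem (s : D.Shading) (d : Dart X M) :
    D.region (next X M d) ∈ s.shaded ↔ D.region d ∉ s.shaded := by
  have h : D.region (D.opp (next X M d)) = D.region d := by
    refine Quotient.sound ?_
    refine ⟨1, ?_⟩
    simp [face, D.opp_opp]
  rw [s.alternates, h]

theorem corner_succ (s : D.Shading) (c : X) (i : ZMod 4) :
    D.region (Sum.inl (c, i + 1)) ∈ s.shaded ↔ D.region (Sum.inl (c, i)) ∉ s.shaded :=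
  s.next_mem (Sum.inl (c, i))

theorem corner_two (s : D.Shading) (c : X) (h : D.region (Sum.inl (c, 0)) ∈ s.shaded) :
    D.region (Sum.inl (c, 2)) ∈ s.shaded := by
  have h1 := s.corner_succ c 0
  have h2 := s.corner_succ c 1
  rw [show (0 : ZMod 4) + 1 = 1 from rfl] at h1
  rw [show (1 : ZMod 4) + 1 = 2 from rfl] at h2
  tauto

theorem corner_one (s : D.Shading) (c : X) (h : D.region (Sum.inl (c, 0)) ∉ s.shaded) :
    D.region (Sum.inl (c, 1)) ∈ s.shaded := by
  have h1 := s.corner_succ c 0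
  rw [show (0 : ZMod 4) + 1 = 1 from rfl] at h1
  tauto

theorem corner_three (s : D.Shading) (c : X) (h : D.region (Sum.inl (c, 0)) ∉ s.shaded) :
    D.region (Sum.inl (c, 3)) ∈ s.shaded := by
  have h1 := s.corner_one c h
  have h2 := s.corner_succ c 1
  have h3 := s.corner_succ c 2
  rw [show (1 : ZMod 4) + 1 = 2 from rfl] at h2
  rw [show (2 : ZMod 4) + 1 = 3 from rfl] at h3
  tauto

noncomputable instance [Finite X] [Finite M] (s : D.Shading) : Fintype s.shaded :=
  Fintype.ofFinite _

open Classical in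
/-- The Tait graph of a checkerboard shaded diagram: one vertex for each shaded region, and one
edge through each crossing `c`, joining the shaded regions at the two shaded corners of `c`, which
are either the corners `0, 2` or the corners `1, 3`. The weight is `+1` in the first case (one
turns counterclockwise through a shaded corner from the under strand to the over strand) and
`-1` in the second. -/
noncomputable def taitGraph (s : D.Shading) : WeightedGraph s.shaded X where
  fst c := if h : D.region (Sum.inl (c, 0)) ∈ s.shaded
    then ⟨D.region (Sum.inl (c, 0)), h⟩ else ⟨D.region (Sum.inl (c, 1)), s.corner_one c h⟩
  snd c := if h : D.region (Sum.inl (c, 0)) ∈ s.shaded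
    then ⟨D.region (Sum.inl (c, 2)), s.corner_two c h⟩
    else ⟨D.region (Sum.inl (c, 3)), s.corner_three c h⟩
  weight c := if D.region (Sum.inl (c, 0)) ∈ s.shaded then 1 else -1

end Shading

end LinkDiagram

/-! Write `d` for the coboundary and `∂W` for the weighted boundary of a graph, so that `L = ∂W ∘
d`. If the graph is connected with weights `±1`, the range of `∂W` is exactly the vectors of sum
zero, so the Laplacian group is `ℤ × ℤ^E / (im d + ker ∂W)`
(`Connected.nonempty_laplacianGroup_equiv`). `G` and `G*` have the same edges, the crossings, and
plane duality says that `ker ∂W` of either graph is `im d` of the other (`ker_weightedBoundary`).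
Hence both groups involve the same sublattice `im d_G + im d_G*`. Duality has three ingredients:
orthogonality, by summation by parts over corners; equality of ranks, by Euler's formula; and
saturation of `im d`, which turns equal rank into equality. -/

namespace WeightedGraph

/-! ### Boundary and coboundary of a weighted graph -/

variable {V U E : Type*} (G : WeightedGraph V E) (H : WeightedGraph U E)

/-- The coboundary map, taking a function on vertices to its differences along edges. -/
def coboundary : (V → ℤ) →ₗ[ℤ] (E → ℤ) where
  toFun p e := p (G.fst e) - p (G.snd e)
  map_add' p q := by ext e; simp; ring
  map_smul' n p := by ext e; simp; ring

@[simp] theorem coboundary_apply (p : V → ℤ) (e : E) :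
    G.coboundary p e = p (G.fst e) - p (G.snd e) := rfl

open Classical in
/-- The multiplication by the edge weights followed by the boundary map. -/
noncomputable def weightedBoundary [Fintype E] : (E → ℤ) →ₗ[ℤ] (V → ℤ) where
  toFun x i := ∑ e, G.weight e * x e *
    ((if G.fst e = i then 1 else 0) - (if G.snd e = i then 1 else 0))
  map_add' x y := by
    ext i
    simp only [Pi.add_apply, ← Finset.sum_add_distrib]
    exact Finset.sum_congr rfl fun e _ => by ring
  map_smul' n x := by
    ext i
    simp only [Pi.smul_apply, smul_eq_mul, RingHom.id_apply, Finset.mul_sum]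
    exact Finset.sum_congr rfl fun e _ => by ring

open Classical in
theorem weightedBoundary_apply [Fintype E] (x : E → ℤ) (i : V) :
    G.weightedBoundary x i = ∑ e, G.weight e * x e *
      ((if G.fst e = i then 1 else 0) - (if G.snd e = i then 1 else 0)) := rfl

open Classical in
theorem laplacian_mulVecLin [Fintype V] [Fintype E] :
    G.laplacian.mulVecLin = G.weightedBoundary ∘ₗ G.coboundary := by
  ext j i
  simp only [LinearMap.comp_apply, Matrix.mulVecLin_apply, LinearMap.single_apply,
    Matrix.mulVec_single_one, Matrix.col_apply, weightedBoundary_apply, coboundary_apply,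
    laplacian, Matrix.sub_apply, Matrix.diagonal_apply, degree, adjacency, Matrix.of_apply,
    Pi.single_apply]
  by_cases h : i = j
  · subst h
    rw [if_pos rfl, ← Finset.sum_sub_distrib]
    refine Finset.sum_congr rfl fun e _ => ?_
    by_cases h1 : G.fst e = i <;> by_cases h2 : G.snd e = i <;> simp [h1, h2]
  · rw [if_neg h, zero_sub, ← Finset.sum_neg_distrib]
    refine Finset.sum_congr rfl fun e _ => ?_
    have hj : j ≠ i := Ne.symm h
    by_cases h1 : G.fst e = i <;> by_cases h2 : G.snd e = i <;>
      by_cases h3 : G.fst e = j <;> by_cases h4 : G.snd e = j <;> simp_all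

/-- A graph is connected when any two vertices satisfy the same predicates among those which do
not separate the two ends of an edge. -/
def Connected : Prop :=
  ∀ P : V → Prop, (∀ e, P (G.fst e) ↔ P (G.snd e)) → ∀ i j, P i → P j

variable {G H}

-- As the weight is its own inverse, it cancels: every difference of the ends of an edge is an
-- integral weighted boundary.
open Classical in
theorem weightedBoundary_single [Fintype E] (hw : ∀ e, G.weight e * G.weight e = 1) (e : E) :
    G.weightedBoundary (Pi.single e (G.weight e)) =
      Pi.single (G.fst e) 1 - Pi.single (G.snd e) 1 := by
  ext i
  rw [weightedBoundary_apply, Finset.sum_eq_single e]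
  · simp [hw, Pi.single_apply, eq_comm]
  · intro b _ hb
    simp [Pi.single_eq_of_ne hb]
  · simp

open Classical in
theorem sum_weightedBoundary [Fintype V] [Fintype E] (x : E → ℤ) :
    ∑ i, G.weightedBoundary x i = 0 := by
  simp only [weightedBoundary_apply]
  rw [Finset.sum_comm]
  refine Finset.sum_eq_zero fun e _ => ?_
  rw [← Finset.mul_sum, Finset.sum_sub_distrib]
  simp

theorem Connected.mem_range_weightedBoundary [Fintype V] [Nonempty V] [Fintype E]
    (hG : G.Connected) (hw : ∀ e, G.weight e * G.weight e = 1) {y : V → ℤ} :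
    y ∈ LinearMap.range G.weightedBoundary ↔ ∑ i, y i = 0 := by
  classical
  refine ⟨?_, fun hy => ?_⟩
  · rintro ⟨x, rfl⟩
    exact sum_weightedBoundary x
  · obtain ⟨v⟩ := ‹Nonempty V›
    -- Being congruent to `v` modulo the range passes along edges, so connectedness spreads it to
    -- all vertices.
    have key : ∀ i, (Pi.single i 1 - Pi.single v 1 : V → ℤ) ∈
        LinearMap.range G.weightedBoundary := by
      intro i
      refine hG (fun i => (Pi.single i 1 - Pi.single v 1 : V → ℤ) ∈
        LinearMap.range G.weightedBoundary) (fun e => ?_) v i (by simp)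
      have he : (Pi.single (G.fst e) 1 - Pi.single (G.snd e) 1 : V → ℤ) ∈
          LinearMap.range G.weightedBoundary := ⟨_, weightedBoundary_single hw e⟩
      rw [← Submodule.add_mem_iff_left _ (x := Pi.single (G.snd e) 1 - Pi.single v 1) he,
        sub_add_sub_cancel']
    have hsum : y = ∑ i, y i • (Pi.single i 1 - Pi.single v 1 : V → ℤ) := by
      simp only [smul_sub, Finset.sum_sub_distrib, ← Finset.sum_smul, hy, zero_smul, sub_zero]
      ext j
      simp [Finset.sum_apply, Pi.single_apply]
    rw [hsum]
    exact Submodule.sum_mem _ fun i _ => Submodule.smul_mem _ _ (key i)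

theorem finrank_range_add_finrank_ker_int {A B : Type*} [AddCommGroup A] [AddCommGroup B]
    [Module.Finite ℤ A] (f : A →ₗ[ℤ] B) :
    Module.finrank ℤ (LinearMap.range f) + Module.finrank ℤ (LinearMap.ker f) =
      Module.finrank ℤ A := by
  rw [← f.quotKerEquivRange.finrank_eq, Submodule.finrank_quotient_add_finrank]

theorem Connected.finrank_range_weightedBoundary [Fintype V] [Nonempty V] [Fintype E]
    (hG : G.Connected) (hw : ∀ e, G.weight e * G.weight e = 1) :
    Module.finrank ℤ (LinearMap.range G.weightedBoundary) + 1 = Fintype.card V := by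
  classical
  let σ : (V → ℤ) →ₗ[ℤ] ℤ := ∑ i, LinearMap.proj i
  have hσ : ∀ y, σ y = ∑ i, y i := fun y => by simp [σ]
  have hker : LinearMap.range G.weightedBoundary = LinearMap.ker σ := by
    ext y
    rw [hG.mem_range_weightedBoundary hw, LinearMap.mem_ker, hσ]
  have hrange : LinearMap.range σ = ⊤ := by
    obtain ⟨v⟩ := ‹Nonempty V›
    refine LinearMap.range_eq_top.2 fun n => ⟨Pi.single v n, ?_⟩
    rw [hσ, Finset.sum_pi_single']
    simp
  have := finrank_range_add_finrank_ker_int σ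
  rw [hrange, finrank_top, Module.finrank_self, Module.finrank_fintype_fun_eq_card] at this
  rw [hker, ← this, add_comm]

theorem Connected.apply_eq_of_coboundary_eq_zero (hG : G.Connected) {p : V → ℤ}
    (hp : G.coboundary p = 0) (i j : V) : p i = p j := by
  refine hG (fun k => p i = p k) (fun e => ?_) i j rfl
  have := congrFun hp e
  simp only [coboundary_apply, Pi.zero_apply, sub_eq_zero] at this
  rw [this]

theorem Connected.finrank_range_coboundary [Fintype V] [Nonempty V] (hG : G.Connected) :
    Module.finrank ℤ (LinearMap.range G.coboundary) + 1 = Fintype.card V := by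
  obtain ⟨v⟩ := ‹Nonempty V›
  let ev : LinearMap.ker G.coboundary →ₗ[ℤ] ℤ :=
    LinearMap.proj v ∘ₗ (LinearMap.ker G.coboundary).subtype
  have hev : Function.Bijective ev := by
    refine ⟨fun p q hpq => Subtype.ext (funext fun i => ?_), fun n => ?_⟩
    · rw [hG.apply_eq_of_coboundary_eq_zero p.2 i v, hG.apply_eq_of_coboundary_eq_zero q.2 i v]
      exact hpq
    · exact ⟨⟨fun _ => n, by ext e; simp⟩, rfl⟩
  have := finrank_range_add_finrank_ker_int G.coboundary
  rwa [(LinearEquiv.ofBijective ev hev).finrank_eq, Module.finrank_self,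
    Module.finrank_fintype_fun_eq_card] at this

/-- The range is saturated: a potential for `k • x` is constant modulo `k` along edges, so after
subtracting its value at `v` it can be divided by `k`. -/
theorem Connected.mem_range_coboundary_of_smul_mem [Nonempty V] (hG : G.Connected) {k : ℤ}
    (hk : k ≠ 0) {x : E → ℤ} (hx : k • x ∈ LinearMap.range G.coboundary) :
    x ∈ LinearMap.range G.coboundary := by
  obtain ⟨p, hp⟩ := hx
  obtain ⟨v⟩ := ‹Nonempty V›
  have he : ∀ e, p (G.fst e) - p (G.snd e) = k * x e := fun e => congrFun hp e
  have key : ∀ i, k ∣ p i - p v := by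
    intro i
    refine hG (fun i => k ∣ p i - p v) (fun e => ?_) v i (by simp)
    have : p (G.fst e) - p v = (p (G.snd e) - p v) + k * x e := by rw [← he]; ring
    rw [this, dvd_add_left (dvd_mul_right _ _)]
  choose q hq using key
  refine ⟨q, funext fun e => mul_left_cancel₀ hk ?_⟩
  rw [← he, coboundary_apply, mul_sub, ← hq, ← hq]
  ring

/-- The cycles of a plane graph are the cocycles of its dual: this follows from orthogonality and
from Euler's formula. -/
theorem ker_weightedBoundary_eq_range_coboundary [Fintype V] [Fintype U] [Fintype E] [Nonempty V]
    [Nonempty U] (hG : G.Connected) (hH : H.Connected) (hw : ∀ e, G.weight e * G.weight e = 1)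
    (hcard : Fintype.card V + Fintype.card U = Fintype.card E + 2)
    (hGH : ∀ p, G.weightedBoundary (H.coboundary p) = 0) :
    LinearMap.ker G.weightedBoundary = LinearMap.range H.coboundary := by
  set K := LinearMap.ker G.weightedBoundary with hK
  have hle : LinearMap.range H.coboundary ≤ K := by
    rintro _ ⟨p, rfl⟩
    exact hGH p
  refine le_antisymm (fun x hx => ?_) hle
  have h1 := hG.finrank_range_weightedBoundary hw
  have h2 := hH.finrank_range_coboundary
  have h3 := finrank_range_add_finrank_ker_int G.weightedBoundary
  rw [Module.finrank_fintype_fun_eq_card, ← hK] at h3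
  let N := (LinearMap.range H.coboundary).comap K.subtype
  have h4 : Module.finrank ℤ N = Module.finrank ℤ (LinearMap.range H.coboundary) :=
    (Submodule.comapSubtypeEquivOfLe hle).finrank_eq
  have h5 := Submodule.finrank_quotient_add_finrank N
  -- Both ranks equal `|E| - |V| + 1 = |U| - 1`, so the quotient is torsion.
  have h6 : Module.finrank ℤ (K ⧸ N) = 0 := by omega
  obtain ⟨k, hk, hkx⟩ := Module.finrank_eq_zero_iff.1 h6 (N.mkQ ⟨x, hx⟩)
  rw [← map_smul, ← LinearMap.mem_ker, Submodule.ker_mkQ] at hkx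
  exact hH.mem_range_coboundary_of_smul_mem hk hkx

/-- The Laplacian group of a connected graph with weights `±1` is the product of `ℤ` and the
quotient of `ℤ^E` by cuts and weighted cycles. -/
theorem Connected.nonempty_laplacianGroup_equiv [Fintype V] [Nonempty V] [Fintype E]
    (hG : G.Connected) (hw : ∀ e, G.weight e * G.weight e = 1) :
    Nonempty (G.LaplacianGroup ≃ₗ[ℤ] ((ℤ × (E → ℤ)) ⧸ (⊥ : Submodule ℤ ℤ).prod
      (LinearMap.range G.coboundary ⊔ LinearMap.ker G.weightedBoundary))) := by
  classical
  have v : V := Classical.arbitrary V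
  -- The copy of `ℤ` at `v` complements the sum-zero vectors; the first coordinate is recovered as
  -- the sum of the entries.
  let φ : (ℤ × (E → ℤ)) →ₗ[ℤ] (V → ℤ) :=
    (LinearMap.single ℤ (fun _ => ℤ) v).coprod G.weightedBoundary
  have hφ : ∀ n x, φ (n, x) = Pi.single v n + G.weightedBoundary x := fun n x => rfl
  have hsum : ∀ n x, ∑ i, φ (n, x) i = n := by
    intro n x
    simp [hφ, Finset.sum_add_distrib, sum_weightedBoundary]
  have hsurj : Function.Surjective φ := by
    intro y
    obtain ⟨x, hx⟩ := (hG.mem_range_weightedBoundary hw (y := y - Pi.single v (∑ i, y i))).2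
      (by simp [Finset.sum_sub_distrib])
    exact ⟨(∑ i, y i, x), by rw [hφ, hx, add_sub_cancel]⟩
  have hker : LinearMap.ker ((LinearMap.range G.laplacian.mulVecLin).mkQ ∘ₗ φ) =
      (⊥ : Submodule ℤ ℤ).prod
        (LinearMap.range G.coboundary ⊔ LinearMap.ker G.weightedBoundary) := by
    ext ⟨n, x⟩
    rw [LinearMap.ker_comp, Submodule.ker_mkQ, Submodule.mem_comap, Submodule.mem_prod,
      Submodule.mem_bot, laplacian_mulVecLin]
    refine ⟨?_, ?_⟩
    · rintro ⟨p, hp⟩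
      have hn : n = 0 := by
        rw [← hsum n x, ← hp]
        exact sum_weightedBoundary _
      subst hn
      refine ⟨rfl, Submodule.mem_sup.2 ⟨_, ⟨p, rfl⟩, x - G.coboundary p, ?_, by simp⟩⟩
      rw [hφ, Pi.single_zero, zero_add] at hp
      rw [LinearMap.mem_ker, map_sub, ← hp, LinearMap.comp_apply, sub_self]
    · rintro ⟨hn, hx⟩
      obtain ⟨_, ⟨p, rfl⟩, z, hz, rfl⟩ := Submodule.mem_sup.1 hx
      refine ⟨p, ?_⟩
      dsimp only at hn
      rw [hφ, hn, Pi.single_zero, zero_add, map_add, LinearMap.mem_ker.1 hz, add_zero,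
        LinearMap.comp_apply]
  rw [← hker]
  exact ⟨(LinearMap.quotKerEquivOfSurjective
    ((LinearMap.range G.laplacian.mulVecLin).mkQ ∘ₗ φ) ((Submodule.mkQ_surjective _).comp hsurj)).symm⟩

end WeightedGraph

/-! ### Counting and summation on the diagram -/

namespace LinkDiagram

variable {X M : Type*} {D : LinkDiagram X M}

theorem region_face (D : LinkDiagram X M) (d : Dart X M) :
    D.region (D.face d) = D.region d :=
  Quotient.sound ⟨-1, by simp⟩

theorem region_opp (D : LinkDiagram X M) (d : Dart X M) :
    D.region (D.opp d) = D.region ((next X M).symm d) := by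
  rw [← D.region_face (D.opp d), face, Equiv.trans_apply, D.opp_opp]

/-- A predicate on darts which is invariant under `next` and `opp` holds everywhere on a connected
diagram as soon as it holds somewhere. -/
theorem IsConnected.induction (hD : D.IsConnected) {P : Dart X M → Prop}
    (hnext : ∀ d, P d ↔ P (next X M d)) (hopp : ∀ d, P d ↔ P (D.opp d)) {a b : Dart X M}
    (ha : P a) : P b := by
  obtain ⟨g, hg, rfl⟩ := hD a b
  have key : ∀ d, P d ↔ P (g d) := by
    induction hg using Subgroup.closure_induction with
    | mem g hg =>
      rcases hg with rfl | rfl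
      · exact hnext
      · exact hopp
    | one => exact fun d => Iff.rfl
    | mul g h _ _ hg hh => exact fun d => (hh d).trans (hg (h d))
    | inv g _ hg => exact fun d => by simpa using (hg (g⁻¹ d)).symm
  exact (key a).1 ha

/-- `opp` is an involution without fixed points, so each arc has exactly two ends. -/
theorem two_mul_card_arc (D : LinkDiagram X M) [Finite X] [Finite M] :
    2 * Nat.card D.Arc = 4 * Nat.card X + 2 * Nat.card M := by
  classical
  let mk : Dart X M → D.Arc := Quotient.mk (Equiv.Perm.SameCycle.setoid D.opp)
  have : Finite D.Arc := inferInstanceAs (Finite (Quotient _))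
  have : Fintype D.Arc := Fintype.ofFinite _
  have hmk : ∀ a b, mk a = mk b ↔ a = b ∨ a = D.opp b := by
    intro a b
    refine Quotient.eq.trans ⟨?_, ?_⟩
    · rintro ⟨i, rfl⟩
      have hsq : D.opp ^ (2 : ℤ) = 1 := by
        ext1 d
        rw [zpow_two, Equiv.Perm.mul_apply, D.opp_opp, Equiv.Perm.one_apply]
      rcases Int.even_or_odd' i with ⟨k, rfl | rfl⟩
      · left; simp [zpow_mul, hsq]
      · right; simp [zpow_add, zpow_mul, hsq, D.opp_opp]
    · rintro (rfl | rfl)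
      · exact ⟨0, by simp⟩
      · exact ⟨1, by simp [D.opp_opp]⟩
  have hfib : ∀ a : D.Arc, Nat.card {d // mk d = a} = 2 := by
    intro a
    obtain ⟨d, rfl⟩ := Quotient.exists_rep a
    have : {e | mk e = mk d} = {d, D.opp d} := by
      ext e
      simp [hmk]
    change Nat.card {e | mk e = mk d} = 2
    rw [this, Nat.card_coe_set_eq, Set.ncard_pair (D.opp_ne d).symm]
  have h := Nat.card_congr (Equiv.sigmaFiberEquiv mk)
  rw [Nat.card_sigma, Finset.sum_congr rfl fun a _ => hfib a, Finset.sum_const, Finset.card_univ,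
    ← Nat.card_eq_fintype_card, smul_eq_mul, Nat.card_sum, Nat.card_prod, Nat.card_prod,
    Nat.card_zmod, Nat.card_zmod] at h
  omega

theorem IsSpherical.card_region [Finite X] [Finite M] (hD : D.IsSpherical) :
    Nat.card D.Region = Nat.card X + 2 := by
  have h1 := hD.2
  have h2 := D.two_mul_card_arc
  rw [eulerChar] at h1
  omega

/-- Connectedness holds vacuously without darts; the Euler characteristic excludes this case. -/
theorem IsSpherical.nonempty_dart [Finite X] [Finite M] (hD : D.IsSpherical) :
    Nonempty (Dart X M) := by
  have : Nonempty D.Region := (Nat.card_pos_iff.1 (by rw [hD.card_region]; omega)).1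
  obtain ⟨r⟩ := this
  exact ⟨(Quotient.exists_rep r).choose⟩

/-- Summation by parts over the corners of the diagram. -/
theorem sum_corner_eq_zero [Fintype X] [Fintype M] (D : LinkDiagram X M)
    (f g : D.Region → ℤ) :
    ∑ d, (f (D.region (next X M d)) - f (D.region ((next X M).symm d))) * g (D.region d) = 0 := by
  simp only [sub_mul, Finset.sum_sub_distrib, sub_eq_zero]
  -- `next (face d) = opp d` lies in the region of `next⁻¹ d`, while `face` preserves the region of
  -- `d`: the two sums agree term by term.
  rw [← Equiv.sum_comp D.face fun d => f (D.region (next X M d)) * g (D.region d)]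
  refine Finset.sum_congr rfl fun d _ => ?_
  rw [D.region_face, ← D.region_opp, face, Equiv.trans_apply, Equiv.apply_symm_apply]

/-! ### Duality of the two Tait graphs -/

namespace Shading

theorem other_other (s : D.Shading) : s.other.other = s := by
  cases s
  simp [other]

theorem nonempty_shaded (s : D.Shading) [h : Nonempty (Dart X M)] : Nonempty s.shaded := by
  obtain ⟨d⟩ := h
  by_cases hd : D.region d ∈ s.shaded
  · exact ⟨⟨_, hd⟩⟩
  · exact ⟨⟨D.region (D.opp d), not_not.1 (mt (s.alternates d).2 hd)⟩⟩

theorem taitGraph_weight_mul_self (s : D.Shading) (c : X) :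
    s.taitGraph.weight c * s.taitGraph.weight c = 1 := by
  simp only [taitGraph]
  split_ifs <;> rfl

theorem card_shaded_add_card_other [Finite X] [Finite M] (hD : D.IsSpherical) (s : D.Shading) :
    Nat.card s.shaded + Nat.card s.other.shaded = Nat.card X + 2 := by
  rw [← hD.card_region]
  exact Set.ncard_add_ncard_compl s.shaded

theorem next_inl (c : X) (i : ZMod 4) :
    next X M (Sum.inl (c, i)) = Sum.inl (c, i + 1) := rfl

theorem next_symm_inl (c : X) (i : ZMod 4) :
    (next X M).symm (Sum.inl (c, i)) = Sum.inl (c, i - 1) := by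
  rw [Equiv.symm_apply_eq, next_inl, sub_add_cancel]

theorem next_symm_inr (m : M) (i : ZMod 2) :
    (next X M).symm (Sum.inr (m, i)) = next X M (Sum.inr (m, i)) := by
  rw [Equiv.symm_apply_eq]
  change Sum.inr (m, i) = Sum.inr (m, i + 1 + 1)
  rw [add_assoc, show (1 : ZMod 2) + 1 = 0 from rfl, add_zero]

theorem taitGraph_of_mem (s : D.Shading) {c : X} (h : D.region (Sum.inl (c, 0)) ∈ s.shaded) :
    ((s.taitGraph.fst c : D.Region) = D.region (Sum.inl (c, 0)) ∧
      (s.taitGraph.snd c : D.Region) = D.region (Sum.inl (c, 2))) ∧ s.taitGraph.weight c = 1 := by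
  simp [taitGraph, h]

theorem taitGraph_of_notMem (s : D.Shading) {c : X} (h : D.region (Sum.inl (c, 0)) ∉ s.shaded) :
    ((s.taitGraph.fst c : D.Region) = D.region (Sum.inl (c, 1)) ∧
      (s.taitGraph.snd c : D.Region) = D.region (Sum.inl (c, 3))) ∧ s.taitGraph.weight c = -1 := by
  simp [taitGraph, h]

/-- The two shaded regions next to an unshaded corner are the two ends of an edge of the Tait
graph. -/
theorem iff_of_notMem (s : D.Shading) {Q : D.Region → Prop}
    (hQ : ∀ c, Q (s.taitGraph.fst c) ↔ Q (s.taitGraph.snd c)) {d : Dart X M}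
    (hd : D.region d ∉ s.shaded) :
    Q (D.region ((next X M).symm d)) ↔ Q (D.region (next X M d)) := by
  rcases d with ⟨c, i⟩ | ⟨m, i⟩
  · rw [next_symm_inl, next_inl]
    have hc := hQ c
    by_cases h0 : D.region (Sum.inl (c, 0)) ∈ s.shaded
    · rw [(s.taitGraph_of_mem h0).1.1, (s.taitGraph_of_mem h0).1.2] at hc
      have h2' := s.corner_two c h0
      fin_cases i
      · exact absurd h0 hd
      · exact hc
      · exact absurd h2' hd
      · exact hc.symm
    · rw [(s.taitGraph_of_notMem h0).1.1, (s.taitGraph_of_notMem h0).1.2] at hc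
      fin_cases i
      · exact hc.symm
      · exact absurd (s.corner_one c h0) hd
      · exact hc
      · exact absurd (s.corner_three c h0) hd
  · rw [next_symm_inr]

/-- The predicate is extended by `False` to unshaded regions and transferred to darts: it holds at
`d` if it holds on either side of `d`. Passing from `d` to `next d` keeps the shaded side if the
corner between them is shaded, and otherwise crosses an edge of the Tait graph. -/
theorem taitGraph_connected (hD : D.IsConnected) (s : D.Shading) : s.taitGraph.Connected := by
  rintro P hP ⟨a, ha⟩ ⟨b, hb⟩ hPa
  let Q : D.Region → Prop := fun r => ∃ h : r ∈ s.shaded, P ⟨r, h⟩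
  have hQv : ∀ v : s.shaded, Q v ↔ P v := fun v => ⟨fun h => h.2, fun h => ⟨v.2, h⟩⟩
  have hQ : ∀ c, Q (s.taitGraph.fst c) ↔ Q (s.taitGraph.snd c) := fun c => by
    rw [hQv, hQv, hP]
  have hQ' : ∀ r ∉ s.shaded, ¬ Q r := fun r hr h => hr h.1
  obtain ⟨d, rfl⟩ := Quotient.exists_rep a
  obtain ⟨e, rfl⟩ := Quotient.exists_rep b
  have hstep : ∀ d, (Q (D.region d) ∨ Q (D.region (D.opp d))) ↔
      (Q (D.region (next X M d)) ∨ Q (D.region (D.opp (next X M d)))) := by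
    intro d
    rw [D.region_opp (next X M d), Equiv.symm_apply_apply, D.region_opp]
    by_cases hd : D.region d ∈ s.shaded
    · have h1 := hQ' _ (mt (s.next_mem d).1 (not_not.2 hd))
      have h2 := hQ' _ ((s.alternates d).1 hd)
      rw [D.region_opp] at h2
      tauto
    · have h1 := hQ' _ hd
      have h2 := s.iff_of_notMem hQ hd
      tauto
  have hopp : ∀ d, (Q (D.region d) ∨ Q (D.region (D.opp d))) ↔
      (Q (D.region (D.opp d)) ∨ Q (D.region (D.opp (D.opp d)))) := by
    intro d
    rw [D.opp_opp, or_comm]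
  have h : Q (D.region e) ∨ Q (D.region (D.opp e)) :=
    hD.induction (P := fun d => Q (D.region d) ∨ Q (D.region (D.opp d))) hstep hopp
      (Or.inl ⟨ha, hPa⟩)
  exact (h.resolve_right (hQ' _ ((s.alternates e).1 hb))).2

/-- Only the two shaded corners contribute. The weight is the sign comparing the chosen orientations
of an edge and its dual, so no further signs enter the duality. -/
theorem sum_corner_eq (s : D.Shading) {f g : D.Region → ℤ}
    (hg : ∀ r ∉ s.shaded, g r = 0) (c : X) :
    ∑ i : ZMod 4, (f (D.region (Sum.inl (c, i + 1))) - f (D.region (Sum.inl (c, i - 1)))) *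
        g (D.region (Sum.inl (c, i))) =
      s.taitGraph.weight c *
        (f (s.other.taitGraph.fst c) - f (s.other.taitGraph.snd c)) *
        (g (s.taitGraph.fst c) - g (s.taitGraph.snd c)) := by
  have hsum : ∀ F : ZMod 4 → ℤ, ∑ i, F i = F 0 + F 1 + F 2 + F 3 := Fin.sum_univ_four
  rw [hsum, show (0 : ZMod 4) + 1 = 1 from rfl, show (0 : ZMod 4) - 1 = 3 from rfl,
    show (1 : ZMod 4) + 1 = 2 from rfl, show (1 : ZMod 4) - 1 = 0 from rfl,
    show (2 : ZMod 4) + 1 = 3 from rfl, show (2 : ZMod 4) - 1 = 1 from rfl,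
    show (3 : ZMod 4) + 1 = 0 from rfl, show (3 : ZMod 4) - 1 = 2 from rfl]
  by_cases h0 : D.region (Sum.inl (c, 0)) ∈ s.shaded
  · obtain ⟨⟨h1, h2⟩, h3⟩ := s.taitGraph_of_mem h0
    have h0' : D.region (Sum.inl (c, 0)) ∉ s.other.shaded := not_not.2 h0
    obtain ⟨⟨h4, h5⟩, -⟩ := s.other.taitGraph_of_notMem h0'
    rw [h1, h2, h3, h4, h5, hg _ (s.other.corner_one c h0'), hg _ (s.other.corner_three c h0')]
    ring
  · obtain ⟨⟨h1, h2⟩, h3⟩ := s.taitGraph_of_notMem h0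
    obtain ⟨⟨h4, h5⟩, -⟩ := s.other.taitGraph_of_mem (c := c) h0
    rw [h1, h2, h3, h4, h5, hg _ h0, hg _ (s.other.corner_two c h0)]
    ring

theorem weightedBoundary_coboundary_other [Fintype X] [Fintype M] (s : D.Shading)
    (p : s.other.shaded → ℤ) :
    s.taitGraph.weightedBoundary (s.other.taitGraph.coboundary p) = 0 := by
  classical
  ext v
  -- The default `0` is harmless: `f` matters only beside shaded corners, where regions are
  -- unshaded.
  let f : D.Region → ℤ := fun r => if h : r ∈ s.other.shaded then p ⟨r, h⟩ else 0
  let g : D.Region → ℤ := fun r => if r = v then 1 else 0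
  have hg : ∀ r ∉ s.shaded, g r = 0 := fun r hr => if_neg fun h => hr (by rw [h]; exact v.2)
  have hfp : ∀ u : s.other.shaded, f u = p u := fun u => dif_pos u.2
  have hgv : ∀ u : s.shaded, g u = if u = v then 1 else 0 := fun u => by
    simp only [g, Subtype.ext_iff]
  have h := D.sum_corner_eq_zero f g
  have hM : ∑ m : M × ZMod 2, (f (D.region (next X M (Sum.inr m))) -
      f (D.region ((next X M).symm (Sum.inr m)))) * g (D.region (Sum.inr m)) = 0 :=
    Finset.sum_eq_zero fun m _ => by rw [next_symm_inr, sub_self, zero_mul]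
  rw [Fintype.sum_sum_type, hM, add_zero, Fintype.sum_prod_type] at h
  simp only [next_symm_inl, next_inl, s.sum_corner_eq hg, hfp, hgv] at h
  rw [WeightedGraph.weightedBoundary_apply, Pi.zero_apply]
  refine Eq.trans (Finset.sum_congr rfl fun c _ => ?_) h
  simp only [WeightedGraph.coboundary_apply]
  congr

theorem ker_weightedBoundary [Fintype X] [Fintype M] (hD : D.IsSpherical) (s : D.Shading) :
    LinearMap.ker s.taitGraph.weightedBoundary = LinearMap.range s.other.taitGraph.coboundary := by
  have := hD.nonempty_dart
  have := s.nonempty_shaded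
  have := s.other.nonempty_shaded
  refine WeightedGraph.ker_weightedBoundary_eq_range_coboundary (taitGraph_connected hD.1 s)
    (taitGraph_connected hD.1 s.other) s.taitGraph_weight_mul_self ?_
    s.weightedBoundary_coboundary_other
  simpa only [Nat.card_eq_fintype_card] using card_shaded_add_card_other hD s

end Shading

end LinkDiagram

/-- For a checkerboard shaded link diagram in the 2-sphere, with Tait graph `G` and with dual `G*`
the Tait graph of the other shading, the Laplacian groups of `G` and `G*` are isomorphic. -/
theorem mainTheorem3 {X M : Type*} [Fintype X] [Fintype M] (D : LinkDiagram X M)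
    (hD : D.IsSpherical) (s : D.Shading) :
    Nonempty (s.taitGraph.LaplacianGroup ≃+ s.other.taitGraph.LaplacianGroup) := by
  have := hD.nonempty_dart
  have := s.nonempty_shaded
  have := s.other.nonempty_shaded
  obtain ⟨f⟩ := (LinkDiagram.Shading.taitGraph_connected hD.1 s).nonempty_laplacianGroup_equiv
    s.taitGraph_weight_mul_self
  obtain ⟨g⟩ := (LinkDiagram.Shading.taitGraph_connected hD.1
    s.other).nonempty_laplacianGroup_equiv s.other.taitGraph_weight_mul_self
  have h := LinkDiagram.Shading.ker_weightedBoundary hD s.other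
  rw [s.other_other] at h
  -- Duality in both directions exchanges the two summands.
  rw [h, sup_comm, ← LinkDiagram.Shading.ker_weightedBoundary hD s] at g
  exact ⟨(f.trans g.symm).toAddEquiv⟩
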